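/- Let $W$ denote the principal branch of the Lambert $W$ function, i.e. the inverse of $w\mapsto we^{w}$ restricted to the region to the right of the curve $\{-\eta\cot\eta+i\eta:-\pi<\eta<\pi\}$ (with $-\eta\cot\eta=-1$ at $\eta=0$) together with the part $0\le\eta<\pi$ of that curve; thus on the cut $(-\infty,-1/e)$ it takes the limit values from the upper half-plane. Put $$M=\int_{1/e}^{\infty}\frac{\operatorname{Im}W(-t)}{\pi t^{2}}\,dt .$$ This integral converges (absolutely) and $M<e$. Let $b\ge 0$ and $c\in\mathbb R$, and consider the equation $$\frac{W(z)}{z}-bz-c=0,\qquad z\in\mathbb C\setminus\{0\},\quad |\arg z|<\pi. \tag{1}$$ If either $b>0$ and $c<M$, or $b=0$ and $0<c<M$, then (1) has exactly one solution $z=x_0$; it is real and positive, and if $b>0$ it satisfies $$0<x_0<\frac{M-c}{b}<\frac{e-c}{b}.$$ In all other cases (1) has no solution. In particular, $W$ has no zero in $\{z\neq 0:\ |\arg z|<\pi\}$. -/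

import Mathlib

/-- The real part `-η cot η` of the point with imaginary part `η ∈ (-π, π)` on the curve that
bounds the range of the principal branch of the Lambert `W` function; the value at `η = 0` is the
limit `-1`. -/
noncomputable def lambertBoundary (η : ℝ) : ℝ :=
  if η = 0 then -1 else -(η * Real.cos η / Real.sin η)

/-- The range of the principal branch: the open region to the right of the curve
`{-η cot η + i η : -π < η < π}`, together with the closed upper half `0 ≤ η < π` of that curve.
The map `w ↦ w * exp w` sends the open region bijectively onto `ℂ \ (-∞, -1/e]`, and the upper half
of the curve bijectively onto the cut `(-∞, -1/e]`. -/
def lambertRange : Set ℂ :=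
  {w | (-Real.pi < w.im ∧ w.im < Real.pi ∧ lambertBoundary w.im < w.re) ∨
    (0 ≤ w.im ∧ w.im < Real.pi ∧ w.re = lambertBoundary w.im)}

/-- The principal branch of the Lambert `W` function, the inverse of `w ↦ w * exp w` on
`lambertRange`. On the cut `(-∞, -1/e)` it takes the limit values from the upper half-plane, so
that `0 < Im W(-t) < π` for `t > 1/e`. -/
noncomputable def lambertW : ℂ → ℂ :=
  Function.invFunOn (fun w : ℂ => w * Complex.exp w) lambertRange

/-- The integrand `Im W(-t) / (π t²)` of the critical value. -/
noncomputable def lambertDensity (t : ℝ) : ℝ :=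
  (lambertW (-(t : ℂ))).im / (Real.pi * t ^ 2)

/-- The critical value `∫_{1/e}^∞ Im W(-t) / (π t²) dt`. -/
noncomputable def lambertCritical : ℝ :=
  ∫ t in Set.Ioi (1 / Real.exp 1), lambertDensity t

/-- `z` is a solution of `W(z)/z - b z - c = 0` in the cut plane `z ≠ 0`, `|arg z| < π`. -/
def IsLambertSolution (b c : ℝ) (z : ℂ) : Prop :=
  (z ≠ 0 ∧ |Complex.arg z| < Real.pi) ∧ lambertW z / z - (b : ℂ) * z - (c : ℂ) = 0

/-! The critical value is exactly 1, the limit of W(z)/z at the origin (`lambertCritical_eq_one`),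
and W(z)/z = exp(-W(z)), so (1) reads exp(-W(z)) = bz + c.

Off the real axis, Im z and Im W(z) have the same sign and |Im W| < π, so exp(-W(z)) and bz have
imaginary parts that cannot agree (`isLambertSolution_ofReal_pos`). On the positive axis put z = u
exp u with u > 0: exp(-u) decreases from 1 to 0 while b u exp u + c is nondecreasing from c, which
settles existence and uniqueness.

For the integral, let p(v) be the boundary point at height v and p exp p = -G(v). Substituting t =
G(v) gives πM = ∫ v G'/G² over (0, π). Along the curve, Im((1 - exp(-p)) p'/p) = 1/G - 1, so an
entire primitive E of (1 - exp(-z))/z yields the antiderivative -v/G - (π - v) + Im E(p(v)). It runs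
from -π to 0. -/

open Set Filter Topology

/-! ### The boundary curve and its image, the cut -/

/-- The modulus of `w * exp w` at the point `-v cot v + i v` of the boundary curve. -/
noncomputable def boundaryModulus (v : ℝ) : ℝ :=
  v / Real.sin v * Real.exp (-(v * Real.cos v / Real.sin v))

/-- The point of the boundary curve with imaginary part `v ∈ (0, π)`. -/
noncomputable def boundaryPoint (v : ℝ) : ℂ :=
  ((-(v * Real.cos v / Real.sin v) : ℝ) : ℂ) + v * Complex.I

theorem mul_cos_lt_sin {v : ℝ} (h0 : 0 < v) (h1 : v < Real.pi) :
    v * Real.cos v < Real.sin v := by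
  rcases lt_or_ge v (Real.pi / 2) with h | h
  · have hc := Real.cos_pos_of_mem_Ioo ⟨by linarith [Real.pi_pos], h⟩
    have := Real.lt_tan h0 h
    rwa [Real.tan_eq_sin_div_cos, lt_div_iff₀ hc] at this
  · have hc := Real.cos_nonpos_of_pi_div_two_le_of_le h (by linarith [Real.pi_pos])
    have hs := Real.sin_pos_of_pos_of_lt_pi h0 h1
    nlinarith

theorem boundaryModulus_pos {v : ℝ} (h0 : 0 < v) (h1 : v < Real.pi) : 0 < boundaryModulus v := by
  have hs := Real.sin_pos_of_pos_of_lt_pi h0 h1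
  unfold boundaryModulus
  positivity

theorem inv_exp_one_lt_boundaryModulus {v : ℝ} (h0 : 0 < v) (h1 : v < Real.pi) :
    1 / Real.exp 1 < boundaryModulus v := by
  have hs := Real.sin_pos_of_pos_of_lt_pi h0 h1
  have ha : 1 < v / Real.sin v := (one_lt_div hs).2 (Real.sin_lt h0)
  have hb : v * Real.cos v / Real.sin v < 1 := (div_lt_one hs).2 (mul_cos_lt_sin h0 h1)
  have hc : 1 / Real.exp 1 < Real.exp (-(v * Real.cos v / Real.sin v)) := by
    rw [one_div, ← Real.exp_neg]
    exact Real.exp_lt_exp.2 (by linarith)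
  unfold boundaryModulus
  nlinarith [Real.exp_pos (-(v * Real.cos v / Real.sin v))]

/-- The derivative of `boundaryModulus` on `(0, π)`. -/
noncomputable def boundaryModulusDeriv (v : ℝ) : ℝ :=
  boundaryModulus v * (((1 - v * Real.cos v / Real.sin v) ^ 2 + v ^ 2) / v)

theorem boundaryModulusDeriv_pos {v : ℝ} (h0 : 0 < v) (h1 : v < Real.pi) :
    0 < boundaryModulusDeriv v := by
  have := boundaryModulus_pos h0 h1
  unfold boundaryModulusDeriv
  positivity

theorem hasDerivAt_mul_cot {v : ℝ} (hs : Real.sin v ≠ 0) :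
    HasDerivAt (fun v : ℝ => v * Real.cos v / Real.sin v)
      (Real.cos v / Real.sin v - v / Real.sin v ^ 2) v := by
  have := ((hasDerivAt_id v).mul (Real.hasDerivAt_cos v)).div (Real.hasDerivAt_sin v) hs
  refine this.congr_deriv ?_
  have := Real.sin_sq_add_cos_sq v
  simp only [id, Pi.mul_apply]
  field_simp
  linear_combination -v * this

/-- The logarithmic derivative is 1/v - 2 cot v + v/sin² v; writing 1/sin² as 1 + cot² completes the
square, which makes positivity evident. -/
theorem hasDerivAt_boundaryModulus {v : ℝ} (h0 : 0 < v) (h1 : v < Real.pi) :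
    HasDerivAt boundaryModulus (boundaryModulusDeriv v) v := by
  have hs := (Real.sin_pos_of_pos_of_lt_pi h0 h1).ne'
  have ha := (hasDerivAt_id v).div (Real.hasDerivAt_sin v) hs
  have hb := (hasDerivAt_mul_cot hs).neg.exp
  refine (ha.mul hb).congr_deriv ?_
  have := Real.sin_sq_add_cos_sq v
  simp only [id, boundaryModulusDeriv, boundaryModulus, Pi.neg_apply, Pi.div_apply]
  generalize Real.exp (-(v * Real.cos v / Real.sin v)) = E
  field_simp
  linear_combination -E * v ^ 2 * this

theorem strictMonoOn_boundaryModulus : StrictMonoOn boundaryModulus (Ioo 0 Real.pi) := by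
  refine strictMonoOn_of_deriv_pos (convex_Ioo _ _)
    (fun v hv => (hasDerivAt_boundaryModulus hv.1 hv.2).continuousAt.continuousWithinAt) ?_
  intro v hv
  rw [interior_Ioo] at hv
  rw [(hasDerivAt_boundaryModulus hv.1 hv.2).deriv]
  exact boundaryModulusDeriv_pos hv.1 hv.2

theorem boundaryPoint_re (v : ℝ) :
    (boundaryPoint v).re = -(v * Real.cos v / Real.sin v) := by
  rw [boundaryPoint, Complex.add_re, Complex.ofReal_re, Complex.re_ofReal_mul, Complex.I_re,
    mul_zero, add_zero]

theorem boundaryPoint_im (v : ℝ) : (boundaryPoint v).im = v := by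
  rw [boundaryPoint, Complex.add_im, Complex.ofReal_im, Complex.im_ofReal_mul, Complex.I_im,
    mul_one, zero_add]

theorem mul_exp_re (w : ℂ) :
    (w * Complex.exp w).re = Real.exp w.re * (w.re * Real.cos w.im - w.im * Real.sin w.im) := by
  rw [Complex.mul_re, Complex.exp_re, Complex.exp_im]
  ring

theorem mul_exp_im (w : ℂ) :
    (w * Complex.exp w).im = Real.exp w.re * (w.re * Real.sin w.im + w.im * Real.cos w.im) := by
  rw [Complex.mul_im, Complex.exp_re, Complex.exp_im]
  ring

theorem boundaryPoint_mul_exp {v : ℝ} (hs : Real.sin v ≠ 0) :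
    boundaryPoint v * Complex.exp (boundaryPoint v) = -(boundaryModulus v : ℂ) := by
  apply Complex.ext
  · rw [mul_exp_re, boundaryPoint_re, boundaryPoint_im, Complex.neg_re, Complex.ofReal_re,
      boundaryModulus]
    have := Real.sin_sq_add_cos_sq v
    generalize Real.exp (-(v * Real.cos v / Real.sin v)) = E
    field_simp
    linear_combination -E * v * this
  · rw [mul_exp_im, boundaryPoint_re, boundaryPoint_im, Complex.neg_im, Complex.ofReal_im,
      neg_zero]
    field_simp
    ring

theorem tendsto_mul_cot_zero :
    Tendsto (fun v : ℝ => v * Real.cos v / Real.sin v) (𝓝[>] 0) (𝓝 1) := by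
  have h : Tendsto (fun v : ℝ => (Real.sinc v)⁻¹ * Real.cos v) (𝓝[>] 0) (𝓝 1) := by
    have : Tendsto (fun v : ℝ => (Real.sinc v)⁻¹ * Real.cos v) (𝓝 0)
        (𝓝 ((Real.sinc 0)⁻¹ * Real.cos 0)) :=
      (Real.continuous_sinc.continuousAt.inv₀ (by simp)).mul Real.continuous_cos.continuousAt
    simp only [Real.sinc_zero, Real.cos_zero, inv_one, mul_one] at this
    exact this.mono_left nhdsWithin_le_nhds
  refine h.congr' ?_
  filter_upwards [self_mem_nhdsWithin] with v hv
  rw [Real.sinc_of_ne_zero (ne_of_gt hv), inv_div]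
  ring

theorem tendsto_boundaryModulus_zero :
    Tendsto boundaryModulus (𝓝[>] 0) (𝓝 (1 / Real.exp 1)) := by
  have h : Tendsto (fun v : ℝ => (Real.sinc v)⁻¹) (𝓝[>] 0) (𝓝 1) := by
    have : Tendsto (fun v : ℝ => (Real.sinc v)⁻¹) (𝓝 0) (𝓝 (Real.sinc 0)⁻¹) :=
      Real.continuous_sinc.continuousAt.inv₀ (by simp)
    simp only [Real.sinc_zero, inv_one] at this
    exact this.mono_left nhdsWithin_le_nhds
  have h2 := h.mul ((Real.continuous_exp.tendsto _).comp tendsto_mul_cot_zero.neg)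
  rw [one_mul, Real.exp_neg, ← one_div] at h2
  refine h2.congr' ?_
  filter_upwards [self_mem_nhdsWithin] with v hv
  simp [Real.sinc_of_ne_zero (ne_of_gt hv), boundaryModulus]

theorem tendsto_sin_pi : Tendsto Real.sin (𝓝[<] Real.pi) (𝓝[>] 0) := by
  refine tendsto_nhdsWithin_iff.2 ⟨?_, ?_⟩
  · have := Real.continuous_sin.tendsto Real.pi
    rw [Real.sin_pi] at this
    exact this.mono_left nhdsWithin_le_nhds
  · filter_upwards [Ioo_mem_nhdsLT Real.pi_pos] with v hv
    exact Real.sin_pos_of_pos_of_lt_pi hv.1 hv.2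

theorem tendsto_neg_mul_cot_pi :
    Tendsto (fun v : ℝ => -(v * Real.cos v / Real.sin v)) (𝓝[<] Real.pi) atTop := by
  have h : Tendsto (fun v : ℝ => -(v * Real.cos v)) (𝓝[<] Real.pi) (𝓝 Real.pi) := by
    have : Tendsto (fun v : ℝ => -(v * Real.cos v)) (𝓝 Real.pi)
        (𝓝 (-(Real.pi * Real.cos Real.pi))) :=
      (continuous_id.mul Real.continuous_cos).neg.tendsto _
    simp only [Real.cos_pi, mul_neg, mul_one, neg_neg] at this
    exact this.mono_left nhdsWithin_le_nhds
  refine (h.pos_mul_atTop Real.pi_pos tendsto_sin_pi.inv_tendsto_nhdsGT_zero).congr ?_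
  intro v
  simp [div_eq_mul_inv]

theorem tendsto_boundaryModulus_pi : Tendsto boundaryModulus (𝓝[<] Real.pi) atTop := by
  have h : Tendsto (fun v : ℝ => Real.exp (-(v * Real.cos v / Real.sin v)))
    (𝓝[<] Real.pi) atTop := Real.tendsto_exp_atTop.comp tendsto_neg_mul_cot_pi
  refine tendsto_atTop_mono' _ ?_ h
  filter_upwards [Ioo_mem_nhdsLT Real.pi_pos] with v hv
  have hs := Real.sin_pos_of_pos_of_lt_pi hv.1 hv.2
  exact le_mul_of_one_le_left (Real.exp_pos _).le ((one_le_div hs).2 (Real.sin_lt hv.1).le)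

theorem boundaryModulus_image : boundaryModulus '' Ioo 0 Real.pi = Ioi (1 / Real.exp 1) := by
  apply Subset.antisymm
  · rintro _ ⟨v, hv, rfl⟩
    exact inv_exp_one_lt_boundaryModulus hv.1 hv.2
  · intro t ht
    obtain ⟨a, ha, hat⟩ := (((tendsto_boundaryModulus_zero.eventually_lt_const ht).and
      (Ioo_mem_nhdsGT Real.pi_pos)).exists.imp fun _ h => And.symm h)
    obtain ⟨b, hb, hbt⟩ := (((tendsto_boundaryModulus_pi.eventually_gt_atTop t).and
      (Ioo_mem_nhdsLT Real.pi_pos)).exists.imp fun _ h => And.symm h)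
    exact isPreconnected_Ioo.intermediate_value ha hb
      (fun v hv => (hasDerivAt_boundaryModulus hv.1 hv.2).continuousAt.continuousWithinAt)
      ⟨hat.le, hbt.le⟩

/-! ### The range of the principal branch and W on the cut -/

theorem lambertBoundary_neg (v : ℝ) : lambertBoundary (-v) = lambertBoundary v := by
  simp [lambertBoundary]

theorem lambertBoundary_of_ne_zero {v : ℝ} (hv : v ≠ 0) :
    lambertBoundary v = -(v * Real.cos v / Real.sin v) := if_neg hv

theorem lambertBoundary_zero : lambertBoundary 0 = -1 := if_pos rfl

theorem mul_exp_im_pos {w : ℂ} (h0 : 0 < w.im) (h1 : w.im < Real.pi)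
    (h : lambertBoundary w.im < w.re) : 0 < (w * Complex.exp w).im := by
  have hs := Real.sin_pos_of_pos_of_lt_pi h0 h1
  rw [lambertBoundary_of_ne_zero h0.ne', neg_lt, ← sub_pos] at h
  rw [mul_exp_im]
  refine mul_pos (Real.exp_pos _) ?_
  have : w.im * Real.cos w.im / Real.sin w.im * Real.sin w.im = w.im * Real.cos w.im :=
    div_mul_cancel₀ _ hs.ne'
  nlinarith

theorem mul_exp_conj (w : ℂ) : (starRingEnd ℂ w) * Complex.exp (starRingEnd ℂ w) =
    starRingEnd ℂ (w * Complex.exp w) := by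
  rw [map_mul, Complex.exp_conj]

theorem mul_exp_im_neg {w : ℂ} (h0 : -Real.pi < w.im) (h1 : w.im < 0)
    (h : lambertBoundary w.im < w.re) : (w * Complex.exp w).im < 0 := by
  have := mul_exp_im_pos (w := starRingEnd ℂ w) (by simpa using h1)
    (by rw [Complex.conj_im]; linarith) (by simpa [lambertBoundary_neg] using h)
  rw [mul_exp_conj, Complex.conj_im] at this
  linarith

theorem eq_boundaryPoint {w : ℂ} (h0 : w.im ≠ 0) (h : w.re = lambertBoundary w.im) :
    w = boundaryPoint w.im := by
  apply Complex.ext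
  · rw [boundaryPoint_re, h, lambertBoundary_of_ne_zero h0]
  · rw [boundaryPoint_im]

theorem boundaryPoint_mem_lambertRange {v : ℝ} (h0 : 0 < v) (h1 : v < Real.pi) :
    boundaryPoint v ∈ lambertRange := by
  right
  rw [boundaryPoint_im, boundaryPoint_re, lambertBoundary_of_ne_zero h0.ne']
  exact ⟨h0.le, h1, rfl⟩

/-- A point of the range of the principal branch is real and at least `-1`, or lies in the interior
off the real axis, where `w * exp w` is not real, or lies on the boundary curve. -/
theorem lambertRange_cases {w : ℂ} (hw : w ∈ lambertRange) :
    (w.im = 0 ∧ -1 ≤ w.re) ∨ (0 < w.im ∧ w.im < Real.pi ∧ 0 < (w * Complex.exp w).im) ∨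
      (w.im < 0 ∧ -Real.pi < w.im ∧ (w * Complex.exp w).im < 0) ∨
      (0 < w.im ∧ w.im < Real.pi ∧ w = boundaryPoint w.im) := by
  rcases hw with ⟨h0, h1, h⟩ | ⟨h0, h1, h⟩
  · rcases lt_trichotomy w.im 0 with hi | hi | hi
    · exact Or.inr (Or.inr (Or.inl ⟨hi, h0, mul_exp_im_neg h0 hi h⟩))
    · rw [hi, lambertBoundary_zero] at h
      exact Or.inl ⟨hi, h.le⟩
    · exact Or.inr (Or.inl ⟨hi, h1, mul_exp_im_pos hi h1 h⟩)
  · rcases h0.eq_or_lt with hi | hi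
    · rw [← hi, lambertBoundary_zero] at h
      exact Or.inl ⟨hi.symm, h.ge⟩
    · exact Or.inr (Or.inr (Or.inr ⟨hi, h1, eq_boundaryPoint hi.ne' h⟩))

/-- The inequality -x ≤ exp(-x - 1) times exp x. It rules out real values of W(-t) for t > 1/e. -/
theorem neg_inv_exp_one_le_mul_exp (x : ℝ) : -(1 / Real.exp 1) ≤ x * Real.exp x := by
  have h := Real.add_one_le_exp (-x - 1)
  have h2 : Real.exp (-x - 1) * Real.exp x = 1 / Real.exp 1 := by
    rw [← Real.exp_add, one_div, ← Real.exp_neg]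
    congr 1
    ring
  have := Real.exp_pos x
  nlinarith

/-- For `invFunOn` a preimage in the range suffices; global injectivity of w exp w is never needed.
-/
theorem lambertW_mem_and_eq {w : ℂ} (hw : w ∈ lambertRange) :
    lambertW (w * Complex.exp w) ∈ lambertRange ∧
      lambertW (w * Complex.exp w) * Complex.exp (lambertW (w * Complex.exp w)) =
        w * Complex.exp w :=
  ⟨Function.invFunOn_mem (f := fun w : ℂ => w * Complex.exp w) ⟨w, hw, rfl⟩,
    Function.invFunOn_eq (f := fun w : ℂ => w * Complex.exp w) ⟨w, hw, rfl⟩⟩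

/-- Only points of the curve can map to -G(v): real points give values at least -1/e, and other
interior points give nonreal values. Monotonicity of G then fixes the height. -/
theorem lambertW_neg_boundaryModulus_im {v : ℝ} (h0 : 0 < v) (h1 : v < Real.pi) :
    (lambertW (-(boundaryModulus v : ℂ))).im = v := by
  have hs : Real.sin v ≠ 0 := (Real.sin_pos_of_pos_of_lt_pi h0 h1).ne'
  have key := lambertW_mem_and_eq (boundaryPoint_mem_lambertRange h0 h1)
  rw [boundaryPoint_mul_exp hs] at key
  obtain ⟨hm, he⟩ := key
  set w := lambertW (-(boundaryModulus v : ℂ))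
  rcases lambertRange_cases hm with ⟨hi, -⟩ | ⟨-, -, hi⟩ | ⟨-, -, hi⟩ | ⟨hi0, hi1, hi⟩
  · have hr := congrArg Complex.re he
    rw [mul_exp_re, hi] at hr
    simp only [Real.cos_zero, mul_one, Real.sin_zero, mul_zero, sub_zero, Complex.neg_re,
      Complex.ofReal_re] at hr
    have := neg_inv_exp_one_le_mul_exp w.re
    have := inv_exp_one_lt_boundaryModulus h0 h1
    linarith
  · rw [he] at hi
    simp at hi
  · rw [he] at hi
    simp at hi
  · rw [hi, boundaryPoint_mul_exp (Real.sin_pos_of_pos_of_lt_pi hi0 hi1).ne', neg_inj,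
      Complex.ofReal_inj] at he
    exact strictMonoOn_boundaryModulus.injOn ⟨hi0, hi1⟩ ⟨h0, h1⟩ he

/-! ### Surjectivity of w exp w onto the cut plane -/

/-- Every point `r * exp (i θ)` of the upper half plane is a value of `w * exp w` at a point of the
open range. -/
theorem exists_mul_exp_eq_polar {r θ : ℝ} (hr : 0 < r) (h0 : 0 < θ) (h1 : θ < Real.pi) :
    ∃ w ∈ lambertRange, w * Complex.exp w = r * Complex.exp (θ * Complex.I) := by
  -- If w = u + iv has argument θ - v, then w exp w has argument θ. This forces u = v cot(θ - v),
  -- and F(v) is the resulting modulus; it vanishes at 0 and is unbounded near θ.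
  set F : ℝ → ℝ := fun v =>
    v / Real.sin (θ - v) * Real.exp (v * Real.cos (θ - v) / Real.sin (θ - v)) with hF
  have hsin : ∀ v, 0 ≤ v → v < θ → 0 < Real.sin (θ - v) := fun v hv hv' =>
    Real.sin_pos_of_pos_of_lt_pi (by linarith) (by linarith)
  obtain ⟨b, hb0, hbθ, hb⟩ : ∃ b, 0 < b ∧ b < θ ∧ r < F b := by
    -- The bound θ/2 keeps cos d ≥ 0, so the exponential is at least 1; the other bound gives r sin
    -- d < r d < θ - d.
    set d := min (θ / 2) (θ / (2 * (r + 1))) with hd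
    have hd0 : 0 < d := by positivity
    have hd1 : d ≤ θ / 2 := min_le_left _ _
    have hd2 : d * (2 * (r + 1)) ≤ θ := (le_div_iff₀ (by positivity)).1 (min_le_right _ _)
    refine ⟨θ - d, by linarith, by linarith, ?_⟩
    have hs : 0 < Real.sin d := Real.sin_pos_of_pos_of_lt_pi hd0 (by linarith)
    have hc : 0 ≤ Real.cos d := Real.cos_nonneg_of_mem_Icc ⟨by linarith, by linarith⟩
    have hsd := Real.sin_lt hd0
    simp only [hF, sub_sub_cancel]
    have he : 1 ≤ Real.exp ((θ - d) * Real.cos d / Real.sin d) := by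
      apply Real.one_le_exp
      have : 0 ≤ θ - d := by linarith
      positivity
    have hq : r < (θ - d) / Real.sin d := by
      rw [lt_div_iff₀ hs]
      nlinarith
    nlinarith
  have hcont : ContinuousOn F (Icc 0 b) := by
    have hne : ∀ v ∈ Icc 0 b, Real.sin (θ - v) ≠ 0 := fun v hv =>
      (hsin v hv.1 (hv.2.trans_lt hbθ)).ne'
    fun_prop (disch := assumption)
  obtain ⟨v, ⟨hv0, hvb⟩, hv⟩ := intermediate_value_Icc hb0.le hcont
    (show r ∈ Icc (F 0) (F b) from ⟨by simp [hF, hr.le], hb.le⟩)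
  have hvpos : 0 < v := by
    rcases hv0.eq_or_lt with rfl | h
    · simp only [hF, zero_div, zero_mul] at hv
      linarith
    · exact h
  have hvθ : v < θ := hvb.trans_lt hbθ
  have hs := hsin v hv0 hvθ
  have hsv : 0 < Real.sin v := Real.sin_pos_of_pos_of_lt_pi hvpos (by linarith)
  refine ⟨⟨v * Real.cos (θ - v) / Real.sin (θ - v), v⟩, Or.inl ⟨?_, ?_, ?_⟩, ?_⟩
  · show -Real.pi < v
    linarith
  · show v < Real.pi
    linarith
  · show lambertBoundary v < v * Real.cos (θ - v) / Real.sin (θ - v)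
    rw [lambertBoundary_of_ne_zero hvpos.ne', ← sub_pos]
    have hsθ : 0 < Real.sin θ := Real.sin_pos_of_pos_of_lt_pi h0 h1
    have : v * Real.cos (θ - v) / Real.sin (θ - v) - -(v * Real.cos v / Real.sin v) =
        v * Real.sin θ / (Real.sin (θ - v) * Real.sin v) := by
      rw [show Real.sin θ = Real.sin ((θ - v) + v) by rw [sub_add_cancel], Real.sin_add]
      field_simp
      ring
    rw [this]
    positivity
  · have hre : ((r : ℂ) * Complex.exp (θ * Complex.I)).re = r * Real.cos θ := by
      rw [Complex.re_ofReal_mul, Complex.exp_ofReal_mul_I_re]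
    have him : ((r : ℂ) * Complex.exp (θ * Complex.I)).im = r * Real.sin θ := by
      rw [Complex.im_ofReal_mul, Complex.exp_ofReal_mul_I_im]
    apply Complex.ext
    · rw [mul_exp_re, hre, ← hv]
      simp only [hF]
      rw [show Real.cos θ = Real.cos ((θ - v) + v) by rw [sub_add_cancel], Real.cos_add]
      field_simp
    · rw [mul_exp_im, him, ← hv]
      simp only [hF]
      rw [show Real.sin θ = Real.sin ((θ - v) + v) by rw [sub_add_cancel], Real.sin_add]
      field_simp
      ring

/-- The range contains only the upper half of the curve, so conjugation fails there; but w exp w is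
real on the curve. -/
theorem conj_mem_lambertRange {w : ℂ} (hw : w ∈ lambertRange)
    (him : (w * Complex.exp w).im ≠ 0) : starRingEnd ℂ w ∈ lambertRange := by
  rcases hw with ⟨h0, h1, h⟩ | ⟨h0, h1, h⟩
  · left
    rw [Complex.conj_im, Complex.conj_re, lambertBoundary_neg]
    exact ⟨by linarith, by linarith, h⟩
  · exfalso
    apply him
    rcases h0.eq_or_lt with hi | hi
    · rw [mul_exp_im, ← hi]
      simp
    · rw [eq_boundaryPoint hi.ne' h,
        boundaryPoint_mul_exp (Real.sin_pos_of_pos_of_lt_pi hi h1).ne']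
      simp

theorem exists_mul_exp_eq_of_im_pos {z : ℂ} (hz : 0 < z.im) :
    ∃ w ∈ lambertRange, w * Complex.exp w = z := by
  have hz0 : z ≠ 0 := fun h => by simp [h] at hz
  obtain ⟨w, hw, h⟩ := exists_mul_exp_eq_polar (norm_pos_iff.2 hz0)
    (lt_of_le_of_ne (Complex.arg_nonneg_iff.2 hz.le) fun h => hz.ne'
      (Complex.arg_eq_zero_iff.1 h.symm).2)
    (lt_of_le_of_ne (Complex.arg_le_pi z) fun h => hz.ne' (Complex.arg_eq_pi_iff.1 h).2)
  exact ⟨w, hw, h.trans (Complex.norm_mul_exp_arg_mul_I z)⟩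

theorem exists_mul_exp_eq_of_pos {x : ℝ} (hx : 0 < x) : ∃ u : ℝ, u * Real.exp u = x := by
  obtain ⟨u, -, h⟩ := intermediate_value_Icc hx.le
    (f := fun u : ℝ => u * Real.exp u) (by fun_prop)
    (show x ∈ Icc _ _ from ⟨by simpa using hx.le, by
      nlinarith [Real.add_one_le_exp x]⟩)
  exact ⟨u, h⟩

theorem ofReal_mem_lambertRange {u : ℝ} (hu : 0 < u) : (u : ℂ) ∈ lambertRange := by
  left
  rw [Complex.ofReal_im, Complex.ofReal_re, lambertBoundary_zero]
  exact ⟨by linarith [Real.pi_pos], Real.pi_pos, by linarith⟩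

theorem im_ne_zero_or_pos {z : ℂ} (hz : z ≠ 0) (ha : |z.arg| < Real.pi) :
    z.im ≠ 0 ∨ ∃ x : ℝ, 0 < x ∧ z = x := by
  by_cases hi : z.im = 0
  · right
    have hzr : z = (z.re : ℂ) := Complex.ext rfl (by simpa using hi)
    refine ⟨z.re, ?_, hzr⟩
    by_contra! h
    rcases h.eq_or_lt with h | h
    · exact hz (by rw [hzr, h, Complex.ofReal_zero])
    · rw [Complex.arg_eq_pi_iff.2 ⟨h, hi⟩, abs_of_pos Real.pi_pos] at ha
      exact lt_irrefl _ ha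
  · exact Or.inl hi

theorem exists_mul_exp_eq {z : ℂ} (hz : z ≠ 0) (ha : |z.arg| < Real.pi) :
    ∃ w ∈ lambertRange, w * Complex.exp w = z := by
  rcases im_ne_zero_or_pos hz ha with hi | ⟨x, hx, rfl⟩
  · rcases lt_or_gt_of_ne hi with hi | hi
    · obtain ⟨w, hw, h⟩ := exists_mul_exp_eq_of_im_pos (z := starRingEnd ℂ z) (by simpa using hi)
      refine ⟨starRingEnd ℂ w, conj_mem_lambertRange hw ?_, ?_⟩
      · rw [h, Complex.conj_im]
        linarith
      · rw [mul_exp_conj, h, Complex.conj_conj]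
    · exact exists_mul_exp_eq_of_im_pos hi
  · obtain ⟨u, rfl⟩ := exists_mul_exp_eq_of_pos hx
    exact ⟨u, ofReal_mem_lambertRange (pos_of_mul_pos_left hx (Real.exp_pos u).le),
      by push_cast; rfl⟩

theorem lambertW_spec {z : ℂ} (hz : z ≠ 0) (ha : |z.arg| < Real.pi) :
    lambertW z ∈ lambertRange ∧ lambertW z * Complex.exp (lambertW z) = z := by
  obtain ⟨w, hw, rfl⟩ := exists_mul_exp_eq hz ha
  exact lambertW_mem_and_eq hw

theorem lambertW_ne_zero {z : ℂ} (hz : z ≠ 0) (ha : |z.arg| < Real.pi) : lambertW z ≠ 0 := by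
  intro h
  have := (lambertW_spec hz ha).2
  rw [h, zero_mul] at this
  exact hz this.symm

/-! ### Solutions of the equation -/

theorem lambertW_div {z : ℂ} (hz : z ≠ 0) (ha : |z.arg| < Real.pi) :
    lambertW z / z = Complex.exp (-lambertW z) := by
  have h := (lambertW_spec hz ha).2
  have he := Complex.exp_ne_zero (lambertW z)
  rw [div_eq_iff hz, Complex.exp_neg, eq_inv_mul_iff_mul_eq₀ he, mul_comm, h]

theorem isLambertSolution_ofReal_pos {b c : ℝ} (hb : 0 ≤ b) {z : ℂ}
    (h : IsLambertSolution b c z) : ∃ x : ℝ, 0 < x ∧ z = x := by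
  obtain ⟨⟨hz, ha⟩, he⟩ := h
  refine (im_ne_zero_or_pos hz ha).resolve_left fun hi => ?_
  obtain ⟨hm, hw⟩ := lambertW_spec hz ha
  rw [lambertW_div hz ha] at he
  have him := congrArg Complex.im he
  rw [Complex.sub_im, Complex.sub_im, Complex.im_ofReal_mul, Complex.ofReal_im, Complex.exp_im,
    Complex.neg_im, Complex.neg_re, Real.sin_neg, Complex.zero_im] at him
  have hE := Real.exp_pos (-(lambertW z).re)
  rcases lambertRange_cases hm with ⟨hi', -⟩ | ⟨h0, h1, h2⟩ | ⟨h0, h1, h2⟩ | ⟨h0, h1, h2⟩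
  · apply hi
    rw [← hw, mul_exp_im, hi']
    simp
  · rw [hw] at h2
    have := Real.sin_pos_of_pos_of_lt_pi h0 h1
    nlinarith [mul_pos hE this, mul_nonneg hb h2.le]
  · rw [hw] at h2
    have := Real.sin_neg_of_neg_of_neg_pi_lt h0 h1
    nlinarith [mul_neg_of_pos_of_neg hE this, mul_nonpos_of_nonneg_of_nonpos hb h2.le]
  · apply hi
    rw [← hw, h2, boundaryPoint_mul_exp (Real.sin_pos_of_pos_of_lt_pi h0 h1).ne']
    simp

theorem lambertW_ofReal {x : ℝ} (hx : 0 < x) :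
    ∃ u : ℝ, 0 < u ∧ u * Real.exp u = x ∧ lambertW x = u := by
  have hx0 : (x : ℂ) ≠ 0 := Complex.ofReal_ne_zero.2 hx.ne'
  have ha : |(x : ℂ).arg| < Real.pi := by
    rw [Complex.arg_ofReal_of_nonneg hx.le, abs_zero]
    exact Real.pi_pos
  obtain ⟨hm, hw⟩ := lambertW_spec hx0 ha
  rcases lambertRange_cases hm with ⟨hi, -⟩ | ⟨-, -, hi⟩ | ⟨-, -, hi⟩ | ⟨h0, h1, h2⟩
  · have hr := congrArg Complex.re hw
    rw [mul_exp_re, hi] at hr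
    simp only [Real.cos_zero, mul_one, Real.sin_zero, mul_zero, sub_zero, Complex.ofReal_re] at hr
    refine ⟨(lambertW x).re, ?_, by linarith, Complex.ext rfl (by simpa using hi)⟩
    exact pos_of_mul_pos_right (by rw [hr]; exact hx) (Real.exp_pos _).le
  · rw [hw] at hi
    simp at hi
  · rw [hw] at hi
    simp at hi
  · rw [h2, boundaryPoint_mul_exp (Real.sin_pos_of_pos_of_lt_pi h0 h1).ne'] at hw
    have := congrArg Complex.re hw
    simp only [Complex.neg_re, Complex.ofReal_re] at this
    linarith [boundaryModulus_pos h0 h1]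

theorem isLambertSolution_iff {b c : ℝ} {x : ℝ} (hx : 0 < x) :
    IsLambertSolution b c x ↔ ∃ u : ℝ, 0 < u ∧ u * Real.exp u = x ∧
      Real.exp (-u) = b * (u * Real.exp u) + c := by
  have hx0 : (x : ℂ) ≠ 0 := Complex.ofReal_ne_zero.2 hx.ne'
  have ha : |(x : ℂ).arg| < Real.pi := by
    rw [Complex.arg_ofReal_of_nonneg hx.le, abs_zero]
    exact Real.pi_pos
  have hmono : ∀ u v : ℝ, 0 < u → u < v → u * Real.exp u < v * Real.exp v := fun u v hu huv =>
    mul_lt_mul'' huv (Real.exp_lt_exp.2 huv) hu.le (Real.exp_pos _).le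
  obtain ⟨u, hu, hux, hW⟩ := lambertW_ofReal hx
  have key : IsLambertSolution b c x ↔ Real.exp (-u) - b * x - c = 0 := by
    rw [IsLambertSolution, lambertW_div hx0 ha, hW]
    constructor
    · rintro ⟨-, h⟩
      exact_mod_cast h
    · exact fun h => ⟨⟨hx0, ha⟩, by exact_mod_cast h⟩
  rw [key]
  constructor
  · exact fun h => ⟨u, hu, hux, by rw [hux]; linarith⟩
  · rintro ⟨v, hv, hvx, h⟩
    have : u = v := by
      rcases lt_trichotomy u v with h' | h' | h'
      · linarith [hmono u v hu h']
      · exact h'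
      · linarith [hmono v u hv h']
    rw [this, h, hvx]
    ring

theorem existsUnique_isLambertSolution {b c : ℝ} (hb : 0 ≤ b)
    (h : (0 < b ∧ c < 1) ∨ (b = 0 ∧ 0 < c ∧ c < 1)) : ∃! z : ℂ, IsLambertSolution b c z := by
  have hex : ∃ u : ℝ, 0 < u ∧ Real.exp (-u) = b * (u * Real.exp u) + c := by
    rcases h with ⟨hb, hc⟩ | ⟨rfl, hc0, hc⟩
    · have hu : 0 < (1 - c) / b := div_pos (by linarith) hb
      have hcont : ContinuousOn (fun u : ℝ => b * (u * Real.exp u) + c - Real.exp (-u))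
          (Icc 0 ((1 - c) / b)) := by fun_prop
      obtain ⟨u, ⟨hu0, -⟩, h⟩ := intermediate_value_Icc hu.le hcont
        (show (0 : ℝ) ∈ Icc _ _ from ⟨by simp; linarith, by
          have h1 : b * ((1 - c) / b) = 1 - c := by field_simp
          have h2 := Real.one_le_exp hu.le
          have h3 : Real.exp (-((1 - c) / b)) ≤ 1 := Real.exp_le_one_iff.2 (by linarith)
          rw [← mul_assoc, h1]
          nlinarith⟩)
      simp only at h
      refine ⟨u, lt_of_le_of_ne hu0 ?_, by linarith⟩
      rintro rfl
      simp at h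
      linarith
    · refine ⟨-Real.log c, neg_pos.2 (Real.log_neg hc0 hc), ?_⟩
      rw [neg_neg, Real.exp_log hc0, zero_mul, zero_add]
  obtain ⟨u, hu, he⟩ := hex
  have hx : 0 < u * Real.exp u := mul_pos hu (Real.exp_pos u)
  refine ⟨((u * Real.exp u : ℝ) : ℂ), (isLambertSolution_iff hx).2 ⟨u, hu, rfl, he⟩, ?_⟩
  intro z hz
  obtain ⟨y, hy, rfl⟩ := isLambertSolution_ofReal_pos hb hz
  obtain ⟨v, hv, rfl, hve⟩ := (isLambertSolution_iff hy).1 hz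
  have hanti : ∀ s t : ℝ, 0 < s → s < t → Real.exp (-s) = b * (s * Real.exp s) + c →
      Real.exp (-t) = b * (t * Real.exp t) + c → False := by
    intro s t hs hst h1 h2
    have h3 : s * Real.exp s < t * Real.exp t :=
      mul_lt_mul'' hst (Real.exp_lt_exp.2 hst) hs.le (Real.exp_pos _).le
    have h4 : Real.exp (-t) < Real.exp (-s) := Real.exp_lt_exp.2 (by linarith)
    nlinarith [mul_le_mul_of_nonneg_left h3.le hb]
  rcases lt_trichotomy u v with h' | h' | h'
  · exact (hanti u v hu h' he hve).elim
  · rw [h']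
  · exact (hanti v u hv h' hve he).elim

/-- Here bx + c = exp(-u) with u > 0. This yields both the upper bound for x and nonexistence in the
remaining cases. -/
theorem lt_of_isLambertSolution {b c x : ℝ} (hx : 0 < x) (h : IsLambertSolution b c x) :
    b * x + c < 1 ∧ 0 < b * x + c := by
  obtain ⟨u, hu, rfl, he⟩ := (isLambertSolution_iff hx).1 h
  rw [← he]
  exact ⟨Real.exp_lt_one_iff.2 (by linarith), Real.exp_pos _⟩

/-! ### Evaluation of the critical integral -/

theorem exists_entire_primitive : ∃ E : ℂ → ℂ, E 0 = 0 ∧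
    ∃ g : ℂ → ℂ, (∀ z, HasDerivAt E (g z) z) ∧ ∀ z, z ≠ 0 → g z = (1 - Complex.exp (-z)) / z := by
  -- The slope of f from 0 is (1 - exp(-z))/z, so `dslope` fills in the removable singularity.
  set f : ℂ → ℂ := fun z => -Complex.exp (-z)
  have hf : Differentiable ℂ f := by fun_prop
  have hg : Differentiable ℂ (dslope f 0) :=
    differentiableOn_univ.1 ((Complex.differentiableOn_dslope univ_mem).2 hf.differentiableOn)
  obtain ⟨E, h0, hE⟩ := hg.isExactOn_univ.with_val_at 0 0
  refine ⟨E, h0, dslope f 0, fun z => hE z (mem_univ z), fun z hz => ?_⟩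
  rw [dslope_of_ne _ hz, slope_def_field]
  simp only [f, neg_zero, Complex.exp_zero, sub_zero]
  ring

theorem hasDerivAt_im_comp_ofReal {E : ℂ → ℂ} {γ : ℝ → ℂ} {e' γ' : ℂ} {v : ℝ}
    (hE : HasDerivAt E e' (γ v)) (hγ : HasDerivAt γ γ' v) :
    HasDerivAt (fun t => (E (γ t)).im) (e' * γ').im v := by
  have := hE.scomp v hγ
  refine (Complex.imCLM.hasFDerivAt.comp_hasDerivAt v this).congr_deriv ?_
  rw [smul_eq_mul, mul_comm]
  rfl

/-- The derivative is real on the real axis away from 0. The formula for g says nothing at 0, so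
each half-line is treated separately. -/
theorem im_ofReal_eq_zero_of_primitive {E g : ℂ → ℂ} (h0 : E 0 = 0)
    (hE : ∀ z, HasDerivAt E (g z) z) (hg : ∀ z, z ≠ 0 → g z = (1 - Complex.exp (-z)) / z)
    (x : ℝ) : (E x).im = 0 := by
  have hd : ∀ t : ℝ, HasDerivAt (fun t : ℝ => (E t).im) (g t).im t := fun t => by
    simpa using hasDerivAt_im_comp_ofReal (hE t) Complex.ofRealCLM.hasDerivAt
  have hne : ∀ t : ℝ, t ≠ 0 → (g t).im = 0 := fun t ht => by
    rw [hg t (Complex.ofReal_ne_zero.2 ht), ← Complex.ofReal_neg, ← Complex.ofReal_exp,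
      ← Complex.ofReal_one, ← Complex.ofReal_sub, ← Complex.ofReal_div, Complex.ofReal_im]
  have hc : Continuous fun t : ℝ => (E t).im :=
    continuous_iff_continuousAt.2 fun t => (hd t).continuousAt
  have hx : (E x).im = (E (0 : ℝ)).im := by
    rcases lt_trichotomy x 0 with h | h | h
    · exact (constant_of_has_deriv_right_zero hc.continuousOn (a := x) (b := 0) (fun t ht => by
        have := (hd t).hasDerivWithinAt (s := Ici t)
        rwa [hne t ht.2.ne] at this) 0 ⟨h.le, le_rfl⟩).symm
    · rw [h]
    · obtain ⟨t, ht, he⟩ := exists_hasDerivAt_eq_slope _ _ h hc.continuousOn fun t _ => hd t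
      rw [hne t ht.1.ne', eq_comm, div_eq_zero_iff] at he
      rcases he with he | he <;> linarith
  rw [hx, Complex.ofReal_zero, h0, Complex.zero_im]

/-- On the half-plane to the right of w the derivative is at most 2/Re w in norm; E is compared at w
and at its real part, where E is real. -/
theorem abs_im_le_of_primitive {E g : ℂ → ℂ} (h0 : E 0 = 0)
    (hE : ∀ z, HasDerivAt E (g z) z) (hg : ∀ z, z ≠ 0 → g z = (1 - Complex.exp (-z)) / z)
    {w : ℂ} (hw : 0 < w.re) : |(E w).im| ≤ 2 / w.re * |w.im| := by
  have hconv : Convex ℝ {z : ℂ | w.re ≤ z.re} := convex_halfSpace_re_ge _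
  have hb := hconv.norm_image_sub_le_of_norm_hasDerivWithin_le (C := 2 / w.re)
    (fun z _ => (hE z).hasDerivWithinAt) (fun z (hz : w.re ≤ z.re) => ?_)
    (x := (w.re : ℂ)) (y := w) (le_refl w.re) (le_refl w.re)
  · have h1 : w - w.re = w.im * Complex.I := by
      rw [sub_eq_iff_eq_add', Complex.re_add_im]
    rw [h1, norm_mul, Complex.norm_I, mul_one, Complex.norm_real, Real.norm_eq_abs] at hb
    have h2 := Complex.abs_im_le_norm (E w - E w.re)
    rw [Complex.sub_im, im_ofReal_eq_zero_of_primitive h0 hE hg, sub_zero] at h2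
    exact h2.trans hb
  · have hz0 : 0 < z.re := hw.trans_le hz
    have hzne : z ≠ 0 := fun h => by simp [h] at hz0
    rw [hg z hzne, norm_div]
    have h1 : ‖1 - Complex.exp (-z)‖ ≤ 2 := by
      refine (norm_sub_le _ _).trans ?_
      rw [norm_one, Complex.norm_exp, Complex.neg_re]
      linarith [Real.exp_le_one_iff.2 (neg_nonpos.2 hz0.le)]
    exact div_le_div₀ (by norm_num) h1 hw (hz.trans (Complex.re_le_norm z))

theorem hasDerivAt_boundaryPoint {v : ℝ} (hs : Real.sin v ≠ 0) :
    HasDerivAt boundaryPoint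
      (((-(Real.cos v / Real.sin v - v / Real.sin v ^ 2) : ℝ) : ℂ) + Complex.I) v := by
  have h1 := (hasDerivAt_mul_cot hs).fun_neg.ofReal_comp
  have h2 := (Complex.ofRealCLM.hasDerivAt (x := v)).mul_const Complex.I
  refine (h1.add h2).congr_deriv ?_
  simp

/-- Since exp(-p)/p = -1/G is real and Im p' = 1, that term contributes 1/G. The -1 is the
derivative of arg p = π - v. -/
theorem boundaryPoint_deriv_im {v : ℝ} (h0 : 0 < v) (h1 : v < Real.pi) :
    ((1 - Complex.exp (-boundaryPoint v)) / boundaryPoint v *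
      (((-(Real.cos v / Real.sin v - v / Real.sin v ^ 2) : ℝ) : ℂ) + Complex.I)).im =
      1 / boundaryModulus v - 1 := by
  have hs : Real.sin v ≠ 0 := (Real.sin_pos_of_pos_of_lt_pi h0 h1).ne'
  have hG := boundaryModulus_pos h0 h1
  have hp : boundaryPoint v ≠ 0 := fun h => by
    have := boundaryPoint_im v
    rw [h, Complex.zero_im] at this
    exact h0.ne this
  have hx : Complex.exp (-boundaryPoint v) / boundaryPoint v =
      ((-(1 / boundaryModulus v) : ℝ) : ℂ) := by
    have h := boundaryPoint_mul_exp hs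
    rw [Complex.exp_neg]
    push_cast
    rw [inv_eq_one_div, div_div, mul_comm, h, one_div, one_div, inv_neg]
  have hi : (boundaryPoint v)⁻¹ =
      ((-(Real.sin v * Real.cos v / v) : ℝ) : ℂ) + ((-(Real.sin v ^ 2 / v) : ℝ) : ℂ) *
        Complex.I := by
    have hsc := Real.sin_sq_add_cos_sq v
    refine inv_eq_of_mul_eq_one_right ?_
    rw [boundaryPoint]
    apply Complex.ext
    · simp only [Complex.mul_re, Complex.mul_im, Complex.add_re, Complex.add_im,
        Complex.ofReal_re, Complex.ofReal_im, Complex.I_re, Complex.I_im, Complex.one_re]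
      field_simp
      linear_combination (v * Real.sin v) * hsc
    · simp only [Complex.mul_re, Complex.mul_im, Complex.add_re, Complex.add_im,
        Complex.ofReal_re, Complex.ofReal_im, Complex.I_re, Complex.I_im, Complex.one_im]
      field_simp
      ring
  rw [sub_div, hx, one_div, hi]
  simp only [Complex.mul_re, Complex.mul_im, Complex.add_re, Complex.add_im, Complex.sub_re,
    Complex.sub_im, Complex.ofReal_re, Complex.ofReal_im, Complex.I_re, Complex.I_im]
  field_simp
  ring

/-- The antiderivative of `v * G' v / G v ^ 2`, with `G` the modulus `boundaryModulus`. -/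
theorem exists_antiderivative : ∃ Φ : ℝ → ℝ,
    (∀ v ∈ Ioo 0 Real.pi,
      HasDerivAt Φ (boundaryModulusDeriv v * (v / boundaryModulus v ^ 2)) v) ∧
    Tendsto Φ (𝓝[>] 0) (𝓝 (-Real.pi)) ∧ Tendsto Φ (𝓝[<] Real.pi) (𝓝 0) := by
  obtain ⟨E, h0, g, hE, hg⟩ := exists_entire_primitive
  refine ⟨fun v => -(v / boundaryModulus v) - (Real.pi - v) + (E (boundaryPoint v)).im,
    fun v hv => ?_, ?_, ?_⟩
  · have hs : Real.sin v ≠ 0 := (Real.sin_pos_of_pos_of_lt_pi hv.1 hv.2).ne'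
    have hG := (boundaryModulus_pos hv.1 hv.2).ne'
    have hp : boundaryPoint v ≠ 0 := fun h => by
      have := boundaryPoint_im v
      rw [h, Complex.zero_im] at this
      exact hv.1.ne this
    have h1 := (hasDerivAt_id v).fun_div (hasDerivAt_boundaryModulus hv.1 hv.2) hG
    have h2 := (hasDerivAt_id v).const_sub Real.pi
    have h3 := hasDerivAt_im_comp_ofReal (hE (boundaryPoint v)) (hasDerivAt_boundaryPoint hs)
    rw [hg _ hp, boundaryPoint_deriv_im hv.1 hv.2] at h3
    refine ((h1.fun_neg.fun_sub h2).fun_add h3).congr_deriv ?_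
    simp only [id]
    field_simp
    ring
  · have hid : Tendsto (fun v : ℝ => v) (𝓝[>] 0) (𝓝 0) := nhdsWithin_le_nhds
    have h1 := hid.div tendsto_boundaryModulus_zero (by positivity)
    have h2 : Tendsto boundaryPoint (𝓝[>] 0) (𝓝 (((-1 : ℝ) : ℂ) + ((0 : ℝ) : ℂ) * Complex.I)) :=
      ((Complex.continuous_ofReal.tendsto _).comp tendsto_mul_cot_zero.neg).add
        (((Complex.continuous_ofReal.tendsto _).comp hid).mul_const _)
    rw [Complex.ofReal_zero, zero_mul, add_zero] at h2
    have h3 := (Complex.continuous_im.tendsto _).comp ((hE _).continuousAt.tendsto.comp h2)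
    rw [im_ofReal_eq_zero_of_primitive h0 hE hg] at h3
    have := (h1.neg.sub (hid.const_sub Real.pi)).add h3
    simpa using this
  · have hid : Tendsto (fun v : ℝ => v) (𝓝[<] Real.pi) (𝓝 Real.pi) := nhdsWithin_le_nhds
    have h1 := hid.div_atTop tendsto_boundaryModulus_pi
    -- The curve escapes to the right with bounded height, so the bound 2 Im p/Re p tends to 0.
    have h3 : Tendsto (fun v => (E (boundaryPoint v)).im) (𝓝[<] Real.pi) (𝓝 0) := by
      have h4 := (tendsto_neg_mul_cot_pi.const_div_atTop 2).mul hid.abs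
      rw [zero_mul] at h4
      refine squeeze_zero_norm' ?_ h4
      filter_upwards [tendsto_neg_mul_cot_pi.eventually_gt_atTop 0] with v hv
      have := abs_im_le_of_primitive h0 hE hg (w := boundaryPoint v)
        (by rwa [boundaryPoint_re])
      rwa [boundaryPoint_re, boundaryPoint_im] at this
    have := (h1.neg.sub (hid.const_sub Real.pi)).add h3
    simpa using this

theorem integrableOn_and_integral_boundary :
    MeasureTheory.IntegrableOn
      (fun v => boundaryModulusDeriv v * (v / boundaryModulus v ^ 2)) (Ioo 0 Real.pi) ∧
    ∫ v in Ioo 0 Real.pi, boundaryModulusDeriv v * (v / boundaryModulus v ^ 2) = Real.pi := by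
  obtain ⟨Φ, hd, ha, hb⟩ := exists_antiderivative
  -- The endpoint limits extend Φ continuously to [0, π]; integrability follows because its
  -- derivative is nonnegative.
  have hcont := continuousOn_Icc_extendFrom_Ioo
    (fun v hv => (hd v hv).continuousAt.continuousWithinAt) ha hb
  have hint := intervalIntegral.integrableOn_deriv_of_nonneg hcont (fun v hv =>
    (hd v hv).congr_of_eventuallyEq (by
      filter_upwards [Ioo_mem_nhds hv.1 hv.2] with u hu
      exact extendFrom_extends (fun u hu => (hd u hu).continuousAt.continuousWithinAt) u hu))
    (fun v hv => by
      have := boundaryModulusDeriv_pos hv.1 hv.2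
      have := hv.1
      positivity)
  refine ⟨hint.mono_set Ioo_subset_Ioc_self, ?_⟩
  rw [← MeasureTheory.integral_Ioc_eq_integral_Ioo,
    ← intervalIntegral.integral_of_le Real.pi_pos.le,
    intervalIntegral.integral_eq_sub_of_hasDerivAt_of_tendsto Real.pi_pos hd
      ((intervalIntegrable_iff_integrableOn_Ioc_of_le Real.pi_pos.le).2 hint) ha hb]
  ring

theorem lambertDensity_boundaryModulus {v : ℝ} (hv : v ∈ Ioo 0 Real.pi) :
    |boundaryModulusDeriv v| • lambertDensity (boundaryModulus v) =
      Real.pi⁻¹ * (boundaryModulusDeriv v * (v / boundaryModulus v ^ 2)) := by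
  rw [abs_of_pos (boundaryModulusDeriv_pos hv.1 hv.2), lambertDensity,
    lambertW_neg_boundaryModulus_im hv.1 hv.2, smul_eq_mul]
  have := (boundaryModulus_pos hv.1 hv.2).ne'
  field_simp

theorem integrableOn_lambertDensity :
    MeasureTheory.IntegrableOn lambertDensity (Ioi (1 / Real.exp 1)) := by
  rw [← boundaryModulus_image, MeasureTheory.integrableOn_image_iff_integrableOn_abs_deriv_smul
    measurableSet_Ioo (fun v hv => (hasDerivAt_boundaryModulus hv.1 hv.2).hasDerivWithinAt)
    strictMonoOn_boundaryModulus.injOn,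
    MeasureTheory.integrableOn_congr_fun (fun v hv => lambertDensity_boundaryModulus hv)
      measurableSet_Ioo]
  exact integrableOn_and_integral_boundary.1.const_mul _

/-- The critical value is `1`, the limit of `W z / z` at the origin. -/
theorem lambertCritical_eq_one : lambertCritical = 1 := by
  rw [lambertCritical, ← boundaryModulus_image,
    MeasureTheory.integral_image_eq_integral_abs_deriv_smul
      measurableSet_Ioo (fun v hv => (hasDerivAt_boundaryModulus hv.1 hv.2).hasDerivWithinAt)
      strictMonoOn_boundaryModulus.injOn,
    MeasureTheory.setIntegral_congr_fun measurableSet_Ioo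
      (fun v hv => lambertDensity_boundaryModulus hv),
    MeasureTheory.integral_const_mul, integrableOn_and_integral_boundary.2,
    inv_mul_cancel₀ Real.pi_ne_zero]

theorem mainTheorem10 :
    (MeasureTheory.IntegrableOn lambertDensity (Set.Ioi (1 / Real.exp 1)) ∧
      lambertCritical < Real.exp 1) ∧
    (∀ b c : ℝ, 0 ≤ b →
      (((0 < b ∧ c < lambertCritical) ∨ (b = 0 ∧ 0 < c ∧ c < lambertCritical)) →
        (∃! z : ℂ, IsLambertSolution b c z) ∧
        (∀ z : ℂ, IsLambertSolution b c z →
          ∃ x : ℝ, z = (x : ℂ) ∧ 0 < x ∧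
            (0 < b → x < (lambertCritical - c) / b ∧
              (lambertCritical - c) / b < (Real.exp 1 - c) / b))) ∧
      (¬ ((0 < b ∧ c < lambertCritical) ∨ (b = 0 ∧ 0 < c ∧ c < lambertCritical)) →
        ¬ ∃ z : ℂ, IsLambertSolution b c z)) ∧
    (∀ z : ℂ, z ≠ 0 → |Complex.arg z| < Real.pi → lambertW z ≠ 0) := by
  have he : 1 < Real.exp 1 := Real.one_lt_exp_iff.2 one_pos
  rw [lambertCritical_eq_one]
  refine ⟨⟨integrableOn_lambertDensity, he⟩, fun b c hb => ⟨fun h => ⟨?_, ?_⟩, ?_⟩,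
    fun z hz ha => lambertW_ne_zero hz ha⟩
  · exact existsUnique_isLambertSolution hb h
  · intro z hz
    obtain ⟨x, hx, rfl⟩ := isLambertSolution_ofReal_pos hb hz
    refine ⟨x, rfl, hx, fun hb => ⟨?_, ?_⟩⟩
    · rw [lt_div_iff₀ hb]
      linarith [(lt_of_isLambertSolution hx hz).1]
    · exact div_lt_div_of_pos_right (by linarith) hb
  · rintro h ⟨z, hz⟩
    obtain ⟨x, hx, rfl⟩ := isLambertSolution_ofReal_pos hb hz
    obtain ⟨h1, h2⟩ := lt_of_isLambertSolution hx hz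
    apply h
    rcases hb.eq_or_lt with rfl | hb
    · rw [zero_mul, zero_add] at h1 h2
      exact Or.inr ⟨rfl, h2, h1⟩
    · exact Or.inl ⟨hb, by nlinarith⟩
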